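/- Let $\mathcal S_\infty$ be the group of permutations of the positive integers that move only finitely many integers, let $\ell(u)$ be the number of inversions of $u$, and let $(\alpha\ \beta)$ denote a transposition. For an integer $k\ge 0$ let $\le_k$ be the $k$-Bruhat order on $\mathcal S_\infty$: the partial order whose covers are the pairs $v<_k v(a\,b)$ with $a\le k<b$ and $\ell(v(a\,b))=\ell(v)+1$. A maximal chain $u=u_0<_k u_1<_k\cdots<_k u_n=w$ of the interval $[u,w]_k$ is encoded by the word ${\bf u}_{\alpha_n\beta_n}\cdots{\bf u}_{\alpha_2\beta_2}{\bf u}_{\alpha_1\beta_1}$ in the symbols ${\bf u}_{\alpha\beta}$ ($0<\alpha<\beta$ integers), where $u_i=(\alpha_i\ \beta_i)u_{i-1}$ for $1\le i\le n$. Consider the relations $$ \begin{array}{cll} (1)& {\bf u}_{\beta\gamma}{\bf u}_{\gamma\delta}{\bf u}_{\alpha\gamma}\equiv {\bf u}_{\beta\delta}{\bf u}_{\alpha\beta}{\bf u}_{\beta\gamma}, & \text{if } \alpha<\beta<\gamma<\delta,\\ (2)& {\bf u}_{\alpha\gamma}{\bf u}_{\gamma\delta}{\bf u}_{\beta\gamma}\equiv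 {\bf u}_{\beta\gamma}{\bf u}_{\alpha\beta}{\bf u}_{\beta\delta}, & \text{if } \alpha<\beta<\gamma<\delta,\\ (3)& {\bf u}_{\alpha\beta}{\bf u}_{\gamma\delta}\equiv {\bf u}_{\gamma\delta}{\bf u}_{\alpha\beta}, & \text{if } \alpha<\beta<\gamma<\delta \text{ or } \alpha<\gamma<\delta<\beta,\\ (4)& {\bf u}_{\alpha\gamma}{\bf u}_{\beta\delta}\equiv {\bf u}_{\beta\delta}{\bf u}_{\alpha\gamma}\equiv 0, & \text{if } \alpha\le\beta<\gamma\le\delta,\\ (5)& {\bf u}_{\beta\gamma}{\bf u}_{\alpha\beta}{\bf u}_{\beta\gamma}\equiv {\bf u}_{\alpha\beta}{\bf u}_{\beta\gamma}{\bf u}_{\alpha\beta}\equiv 0, & \text{if } \alpha<\beta<\gamma. \end{array} $$ A relation is applied to a word by replacing a segment of consecutive letters equal to one side of the relation by another side. Theorem. Let $u\le_k w$. Then for any two maximal chains of $[u,w]_k$, the word of one can be transformed into the word of the other by a finite sequence of applications of the relations (1)–(3), each in either direction, in which every intermediate word again encodes a maximal chain of $[u,w]_k$. Moreover, none of the relations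 (4), (5) can be applied to a word that encodes a maximal chain of $[u,w]_k$: no such word contains a segment of consecutive letters equal to one of the words that (4) and (5) equate to $0$. -/

import Mathlib

/-- The group `S_∞` of the permutations of the positive integers that move only finitely many
integers. -/
def SInfty : Subgroup (Equiv.Perm ℕ+) where
  carrier := {σ | {n | σ n ≠ n}.Finite}
  one_mem' := by simp
  mul_mem' := by
    intro σ τ hσ hτ
    refine (Set.Finite.union hσ hτ).subset ?_
    intro n hn
    by_contra h
    simp only [Set.mem_union, Set.mem_ofPred_eq, not_or, not_not] at h
    exact hn (by rw [Equiv.Perm.mul_apply, h.2, h.1])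
  inv_mem' := by
    intro σ hσ
    refine Set.Finite.subset hσ ?_
    intro n hn h
    exact hn (by rw [Equiv.Perm.inv_eq_iff_eq]; exact h.symm)

namespace SInfty

/-- The transposition `(a b)`, as an element of `S_∞`. -/
def transp (a b : ℕ+) : SInfty :=
  ⟨Equiv.swap a b, by
    refine (Set.toFinite {a, b}).subset ?_
    intro n hn
    by_contra h
    simp only [Set.mem_insert_iff, Set.mem_singleton_iff, not_or] at h
    exact hn (Equiv.swap_apply_of_ne_of_ne h.1 h.2)⟩

/-- The inversions of a permutation. -/
def inversions (u : SInfty) : Set (ℕ+ × ℕ+) :=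
  {p | p.1 < p.2 ∧ u.1 p.2 < u.1 p.1}

theorem inversions_finite (u : SInfty) : (inversions u).Finite := by
  obtain ⟨N, hN⟩ := Set.Finite.bddAbove u.2
  refine ((Set.finite_Iic N).prod (Set.finite_Iic N)).subset ?_
  rintro ⟨i, j⟩ ⟨h1, h2⟩
  have fix : ∀ n, N < n → u.1 n = n := fun n hn => by
    by_contra h
    exact absurd (hN h) (not_le.2 hn)
  have hj : j ≤ N := by
    by_contra! h
    simp only [fix j h] at h1 h2
    have := u.1.injective (fix _ (h.trans h2))
    rw [this] at h2
    exact absurd h1 (not_lt.2 h2.le)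
  exact ⟨h1.le.trans hj, hj⟩

/-- The length `ℓ(u)`: the number of inversions of `u`. -/
noncomputable def length (u : SInfty) : ℕ := (inversions u).ncard

/-- A step of the `k`-Bruhat order: `w = v (a b)` with `a ≤ k < b` and `ℓ(w) = ℓ(v) + 1`. -/
def KStep (k : ℕ) (v w : SInfty) : Prop :=
  ∃ a b : ℕ+, (a : ℕ) ≤ k ∧ k < (b : ℕ) ∧ w = v * transp a b ∧ length w = length v + 1

theorem length_lt_of_kSteps {k : ℕ} {v w : SInfty} (h : Relation.ReflTransGen (KStep k) v w) :
    v = w ∨ length v < length w := by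
  induction h with
  | refl => exact Or.inl rfl
  | tail _ hs ih =>
    obtain ⟨a, b, -, -, -, hl⟩ := hs
    right
    rcases ih with rfl | ih <;> omega

/-- The `k`-Bruhat order `≤_k` on `S_∞`: the partial order generated by the steps `KStep k`. -/
@[reducible] def kBruhat (k : ℕ) : PartialOrder SInfty where
  le := Relation.ReflTransGen (KStep k)
  le_refl _ := Relation.ReflTransGen.refl
  le_trans _ _ _ := Relation.ReflTransGen.trans
  le_antisymm v w h h' := by
    rcases length_lt_of_kSteps h with e | e
    · exact e
    · rcases length_lt_of_kSteps h' with e' | e'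
      · exact e'.symm
      · omega

/-- `u ≤_k w`. -/
def KLe (k : ℕ) (u w : SInfty) : Prop := (kBruhat k).le u w

/-- `w` covers `v` in the `k`-Bruhat order: `v <_k w`, and nothing lies strictly between. -/
def KCovBy (k : ℕ) (v w : SInfty) : Prop := @CovBy SInfty (kBruhat k).toLT v w

/-- The covers of the `k`-Bruhat order are exactly its defining steps. -/
theorem kCovBy_iff_kStep {k : ℕ} {v w : SInfty} : KCovBy k v w ↔ KStep k v w := by
  let _ := kBruhat k
  have key : ∀ {x y : SInfty}, x < y → length x < length y := fun {x y} h =>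
    (length_lt_of_kSteps h.le).resolve_left h.ne
  have step : ∀ {x y : SInfty}, KStep k x y → x < y := fun {x y} h => by
    refine lt_of_le_of_ne (Relation.ReflTransGen.single h) ?_
    rintro rfl
    obtain ⟨a, b, -, -, -, hl⟩ := h
    omega
  constructor
  · intro h
    rcases Relation.ReflTransGen.cases_head (show Relation.ReflTransGen (KStep k) v w from h.1.le)
      with e | ⟨c, hc, hcw⟩
    · exact absurd e h.1.ne
    · rcases eq_or_lt_of_le (show c ≤ w from hcw) with rfl | hlt
      · exact hc
      · exact absurd hlt (h.2 (step hc))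
  · intro h
    refine ⟨step h, fun z h1 h2 => ?_⟩
    have h1' := key h1
    have h2' := key h2
    obtain ⟨a, b, -, -, -, hl⟩ := h
    omega

end SInfty

/-- The generators `u_{αβ}`, indexed by integers `0 < α < β`. -/
structure Gen where
  fst : ℕ+
  snd : ℕ+
  lt : fst < snd

/-- A composition `u_{α_n β_n} ⋯ u_{α_2 β_2} u_{α_1 β_1}`, written in this order: the head of the
list is the leftmost generator, and the last entry of the list is the generator applied first. -/
abbrev GenWord := List Gen

/-- The transposition `(α β)` of a generator. -/
def Gen.perm (g : Gen) : SInfty := SInfty.transp g.fst g.snd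

/-- `IsMaximalChain k u x w`: the word `x = u_{α_n β_n} ⋯ u_{α_1 β_1}` encodes a maximal chain
`u = u_0 <_k u_1 <_k ⋯ <_k u_n = w` of the interval `[u,w]_k`, that is, `u_i = (α_i β_i) u_{i-1}`
and `u_i` covers `u_{i-1}` in the `k`-Bruhat order for each `i`, and `u_n = w`. -/
inductive IsMaximalChain (k : ℕ) (u : SInfty) : GenWord → SInfty → Prop
  | nil : IsMaximalChain k u [] u
  | cons (g : Gen) {x : GenWord} {v : SInfty} :
      IsMaximalChain k u x v → SInfty.KCovBy k v (g.perm * v) →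
        IsMaximalChain k u (g :: x) (g.perm * v)

/-- Every cover of the `k`-Bruhat order is encoded by exactly one generator, so that words encode
saturated chains bijectively. -/
theorem existsUnique_gen_of_kCovBy {k : ℕ} {v w : SInfty} (h : SInfty.KCovBy k v w) :
    ∃! g : Gen, w = g.perm * v := by
  obtain ⟨a, b, ha, hb, rfl, -⟩ := SInfty.kCovBy_iff_kStep.1 h
  have hab : a ≠ b := by rintro rfl; omega
  have hne : v.1 a ≠ v.1 b := fun e => hab (v.1.injective e)
  have conj : v * SInfty.transp a b = SInfty.transp (v.1 a) (v.1 b) * v := by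
    apply Subtype.ext
    exact Equiv.mul_swap_eq_swap_mul v.1 a b
  have ex : ∃ g : Gen, v * SInfty.transp a b = g.perm * v := by
    rcases lt_or_gt_of_ne hne with hlt | hlt
    · exact ⟨⟨_, _, hlt⟩, conj⟩
    · refine ⟨⟨_, _, hlt⟩, conj.trans ?_⟩
      congr 1
      exact Subtype.ext (Equiv.swap_comm _ _)
  obtain ⟨g, hg⟩ := ex
  refine ⟨g, hg, ?_⟩
  rintro ⟨c, d, hcd⟩ hg'
  obtain ⟨p, q, hpq⟩ := g
  have e : Equiv.swap c d = Equiv.swap p q :=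
    congrArg Subtype.val (mul_right_cancel (hg'.symm.trans hg))
  have h1 : Equiv.swap p q c = d := by rw [← e, Equiv.swap_apply_left]
  rw [Equiv.swap_apply_def] at h1
  split_ifs at h1 with h2 h3
  · subst h2 h1; rfl
  · subst h3 h1; exact absurd hcd (not_lt.2 hpq.le)
  · exact absurd h1 hcd.ne

/-- The relations (1), (2) and (3), between a left-hand side and a right-hand side. -/
inductive BraidRel : GenWord → GenWord → Prop
  | rel1 {α β γ δ : ℕ+} (h₁ : α < β) (h₂ : β < γ) (h₃ : γ < δ) :
      BraidRel [⟨β, γ, h₂⟩, ⟨γ, δ, h₃⟩, ⟨α, γ, h₁.trans h₂⟩]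
        [⟨β, δ, h₂.trans h₃⟩, ⟨α, β, h₁⟩, ⟨β, γ, h₂⟩]
  | rel2 {α β γ δ : ℕ+} (h₁ : α < β) (h₂ : β < γ) (h₃ : γ < δ) :
      BraidRel [⟨α, γ, h₁.trans h₂⟩, ⟨γ, δ, h₃⟩, ⟨β, γ, h₂⟩]
        [⟨β, γ, h₂⟩, ⟨α, β, h₁⟩, ⟨β, δ, h₂.trans h₃⟩]
  | rel3 {α β γ δ : ℕ+} (h₁ : α < β) (h₂ : γ < δ) (h : β < γ ∨ (α < γ ∧ δ < β)) :
      BraidRel [⟨α, β, h₁⟩, ⟨γ, δ, h₂⟩] [⟨γ, δ, h₂⟩, ⟨α, β, h₁⟩]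

/-- The words that the relations (4) and (5) equate to `0`. -/
inductive ZeroRel : GenWord → Prop
  | rel4 {α β γ δ : ℕ+} (h₁ : α ≤ β) (h₂ : β < γ) (h₃ : γ ≤ δ) :
      ZeroRel [⟨α, γ, h₁.trans_lt h₂⟩, ⟨β, δ, h₂.trans_le h₃⟩]
  | rel4' {α β γ δ : ℕ+} (h₁ : α ≤ β) (h₂ : β < γ) (h₃ : γ ≤ δ) :
      ZeroRel [⟨β, δ, h₂.trans_le h₃⟩, ⟨α, γ, h₁.trans_lt h₂⟩]
  | rel5 {α β γ : ℕ+} (h₁ : α < β) (h₂ : β < γ) :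
      ZeroRel [⟨β, γ, h₂⟩, ⟨α, β, h₁⟩, ⟨β, γ, h₂⟩]
  | rel5' {α β γ : ℕ+} (h₁ : α < β) (h₂ : β < γ) :
      ZeroRel [⟨α, β, h₁⟩, ⟨β, γ, h₂⟩, ⟨α, β, h₁⟩]

/-- `y` is obtained from `x` by applying one of the relations (1)-(3), in either direction, to a
segment of consecutive generators. -/
def BraidMove (x y : GenWord) : Prop :=
  ∃ l s t r : GenWord, (BraidRel s t ∨ BraidRel t s) ∧ x = l ++ s ++ r ∧ y = l ++ t ++ r

/-- One of the relations (4), (5) can be applied to a segment of consecutive generators of `x`. -/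
def ZeroApplies (x : GenWord) : Prop :=
  ∃ l s r : GenWord, ZeroRel s ∧ x = l ++ s ++ r

/-! Write `P = v⁻¹` for the positions of the values of `v`. The letter `(α β)` replaces `P` by `P *
(α β)`, and it is a cover exactly when `P α ≤ k < P β` and no value strictly between `α` and `β` has
a position strictly between `P α` and `P β`. Words violating (4) or (5) contradict these
inequalities.

For connectedness put `ζ = w u⁻¹`. Whether a chain from `u` to `w` exists is decided by
`Admissible`: values at positions at most `k` do not fall under `ζ`, the others do not rise, and
non-inversions within each block of positions stay in order. Every chain gives this
(`Walk.admissible`) and it suffices (`Admissible.exists_walk`). So a first segment extends to a full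
chain as soon as it leaves an admissible pair.

If `ζ ≠ 1`, let `α` be the largest value raised by `ζ` and `β` the least value above `α` with `ζ β ≤
α`. The letter `(α β)` depends on `ζ` alone. By induction on length, chains with a common first
letter are linked, so it is enough to link every chain to one that starts with `(α β)`
(`Walk.exists_linked_top`). Suppose a chain starts with `(c d)`. By induction its tail may be
exchanged for any other, and the new tail is chosen so that a relation brings `(α β)` to the front:
(3) if `c < α` and `d ≠ β`; (1) if `c < α` and `d = β`; (2), or (3) used twice, if `c = α` and `d >
β`. -/

namespace SInfty

/-! ### Length under a transposition of positions -/

theorem transp_apply_eq (v : SInfty) (a b c : ℕ+) :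
    (v * transp a b).1 c = v.1 (Equiv.swap a b c) := rfl

/-- The involution of the ordered pairs that applies `(a b)` to both entries whenever the result
is again ordered. -/
def pairSwap (a b : ℕ+) (p : ℕ+ × ℕ+) : ℕ+ × ℕ+ :=
  if Equiv.swap a b p.1 < Equiv.swap a b p.2 then (Equiv.swap a b p.1, Equiv.swap a b p.2) else p

theorem pairSwap_pairSwap (a b : ℕ+) {p : ℕ+ × ℕ+} (hp : p.1 < p.2) :
    pairSwap a b (pairSwap a b p) = p := by
  unfold pairSwap
  split_ifs with h1 h2 <;> simp_all

theorem pairSwap_lt (a b : ℕ+) {p : ℕ+ × ℕ+} (hp : p.1 < p.2) :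
    (pairSwap a b p).1 < (pairSwap a b p).2 := by
  unfold pairSwap
  split_ifs with h1 <;> simp_all

/-- A pair whose order `(a b)` reverses is `(a, j)` or `(i, b)` with its other entry between `a` and
`b`. The product has a larger value at `a` and a smaller one at `b`, so such an inversion survives
in place. -/
theorem pairSwap_mem_inversions {v : SInfty} {a b : ℕ+} (hab : a < b) (h : v.1 a < v.1 b)
    {p : ℕ+ × ℕ+} (hp : p ∈ inversions v) : pairSwap a b p ∈ inversions (v * transp a b) := by
  obtain ⟨i, j⟩ := p
  obtain ⟨hij, hv⟩ := hp
  refine ⟨pairSwap_lt a b hij, ?_⟩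
  simp only [transp_apply_eq]
  unfold pairSwap
  simp only at hij hv ⊢
  split_ifs with h1
  · simpa using hv
  · simp only [Equiv.swap_apply_def] at h1 ⊢
    grind

theorem pairSwap_self (a b : ℕ+) (hab : a < b) : pairSwap a b (a, b) = (a, b) := by
  simp [pairSwap, hab.le]

theorem image_pairSwap_subset {v : SInfty} {a b : ℕ+} (hab : a < b) (h : v.1 a < v.1 b) :
    insert (a, b) (pairSwap a b '' inversions v) ⊆ inversions (v * transp a b) := by
  rintro q (rfl | ⟨p, hp, rfl⟩)
  · exact ⟨hab, by simp only [transp_apply_eq]; simpa using h⟩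
  · exact pairSwap_mem_inversions hab h hp

theorem notMem_image_pairSwap {v : SInfty} {a b : ℕ+} {q : ℕ+ × ℕ+}
    (hq : pairSwap a b q ∉ inversions v) : q ∉ pairSwap a b '' inversions v := by
  rintro ⟨p, hp, rfl⟩
  rw [pairSwap_pairSwap a b hp.1] at hq
  exact hq hp

theorem ncard_insert_image_pairSwap {v : SInfty} {a b : ℕ+} (hab : a < b) (h : v.1 a < v.1 b) :
    (insert (a, b) (pairSwap a b '' inversions v)).ncard = length v + 1 := by
  rw [Set.ncard_insert_of_notMem _ ((inversions_finite v).image _), Set.InjOn.ncard_image]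
  · rfl
  · intro p hp q hq hpq
    rw [← pairSwap_pairSwap a b hp.1, hpq, pairSwap_pairSwap a b hq.1]
  · apply notMem_image_pairSwap
    rw [pairSwap_self a b hab]
    exact fun hm => absurd hm.2 h.not_gt

theorem length_lt_length_mul_transp {v : SInfty} {a b : ℕ+} (hab : a < b) (h : v.1 a < v.1 b) :
    length v < length (v * transp a b) := by
  have := Set.ncard_le_ncard (image_pairSwap_subset hab h) (inversions_finite _)
  rw [ncard_insert_image_pairSwap hab h] at this
  exact this

/-- `pairSwap` injects the inversions of `v` into those of the product and misses `(a, b)`. The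
length therefore rises by exactly one when nothing else is missed; an intermediate `c` makes `(a,
c)` a second missed inversion. -/
theorem length_mul_transp_eq_iff {v : SInfty} {a b : ℕ+} (hab : a < b) (h : v.1 a < v.1 b) :
    length (v * transp a b) = length v + 1 ↔
      ∀ c, a < c → c < b → ¬ (v.1 a < v.1 c ∧ v.1 c < v.1 b) := by
  constructor
  · rintro hl c hac hcb ⟨h1, h2⟩
    have heq := Set.eq_of_subset_of_ncard_le (image_pairSwap_subset hab h)
      (by rw [ncard_insert_image_pairSwap hab h]; exact hl.le) (inversions_finite _)
    have hmem : (a, c) ∈ inversions (v * transp a b) := by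
      refine ⟨hac, ?_⟩
      rw [transp_apply_eq, transp_apply_eq, Equiv.swap_apply_left,
        Equiv.swap_apply_of_ne_of_ne hac.ne' hcb.ne]
      exact h2
    rw [← heq] at hmem
    rcases hmem with e | hm
    · exact hcb.ne (congrArg Prod.snd e)
    · refine notMem_image_pairSwap ?_ hm
      have : pairSwap a b (a, c) = (a, c) := by
        simp [pairSwap, Equiv.swap_apply_of_ne_of_ne hac.ne' hcb.ne, hcb.le]
      rw [this]
      exact fun hm => absurd hm.2 h1.not_gt
  · intro hc
    rw [← ncard_insert_image_pairSwap hab h]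
    unfold length
    congr 1
    refine subset_antisymm ?_ (image_pairSwap_subset hab h)
    rintro ⟨i, j⟩ ⟨hij, hv⟩
    by_cases he : (i, j) = (a, b)
    · exact Or.inl he
    refine Or.inr ⟨pairSwap a b (i, j), ⟨pairSwap_lt a b hij, ?_⟩, pairSwap_pairSwap a b hij⟩
    simp only [transp_apply_eq] at hv hij
    unfold pairSwap
    split_ifs with h1
    · exact hv
    · simp only [Equiv.swap_apply_def] at h1 hv ⊢
      have hi := hc i
      have hj := hc j
      have inj1 : i ≠ b → v.1 i < v.1 b ∨ v.1 b < v.1 i :=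
        fun e => lt_or_gt_of_ne fun e' => e (v.1.injective e')
      have inj2 : j ≠ a → v.1 j < v.1 a ∨ v.1 a < v.1 j :=
        fun e => lt_or_gt_of_ne fun e' => e (v.1.injective e')
      grind

end SInfty

/-! ### Chains in terms of the positions of values -/

/-- In terms of the positions `P = v⁻¹`: the transposition `g` of two values of `v` is a cover of
the `k`-Bruhat order. -/
def Cov (k : ℕ) (P : Equiv.Perm ℕ+) (g : Gen) : Prop :=
  (P g.fst : ℕ) ≤ k ∧ k < (P g.snd : ℕ) ∧
    ∀ x, g.fst < x → x < g.snd → ¬ (P g.fst < P x ∧ P x < P g.snd)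

theorem kCovBy_iff_cov {k : ℕ} {v : SInfty} {g : Gen} :
    SInfty.KCovBy k v (g.perm * v) ↔ Cov k (v.1⁻¹) g := by
  have conj : ∀ a b : ℕ+, v * SInfty.transp a b = SInfty.transp (v.1 a) (v.1 b) * v :=
    fun a b => Subtype.ext (Equiv.mul_swap_eq_swap_mul v.1 a b)
  have main : ∀ a b : ℕ+, (a : ℕ) ≤ k → k < (b : ℕ) → v.1 a = g.fst → v.1 b = g.snd →
      (SInfty.length (v * SInfty.transp a b) = SInfty.length v + 1 ↔ Cov k (v.1⁻¹) g) := by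
    intro a b ha hb hva hvb
    have hab : a < b := by
      rw [← PNat.coe_lt_coe]; omega
    rw [SInfty.length_mul_transp_eq_iff hab (by rw [hva, hvb]; exact g.lt)]
    have e1 : v.1⁻¹ g.fst = a := by rw [← hva]; simp
    have e2 : v.1⁻¹ g.snd = b := by rw [← hvb]; simp
    unfold Cov
    rw [e1, e2, hva, hvb]
    constructor
    · intro h
      refine ⟨ha, hb, fun x h1 h2 h3 => h _ h3.1 h3.2 ?_⟩
      simpa using ⟨h1, h2⟩
    · rintro ⟨-, -, h⟩ c h1 h2 h3
      exact h (v.1 c) h3.1 h3.2 (by simpa using ⟨h1, h2⟩)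
  rw [SInfty.kCovBy_iff_kStep]
  constructor
  · rintro ⟨a, b, ha, hb, he, hl⟩
    have hab : a < b := by
      rw [← PNat.coe_lt_coe]; omega
    rw [he] at hl
    have hlt : v.1 a < v.1 b := by
      by_contra hle
      have hlt : v.1 b < v.1 a :=
        lt_of_le_of_ne (not_lt.1 hle) fun e => hab.ne' (v.1.injective e)
      have := SInfty.length_lt_length_mul_transp (v := v * SInfty.transp a b) hab
        (by simp only [SInfty.transp_apply_eq]; simpa using hlt)
      have e : v * SInfty.transp a b * SInfty.transp a b = v := by
        apply Subtype.ext
        ext x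
        simp [SInfty.transp]
      rw [e] at this
      omega
    have hg : g = ⟨v.1 a, v.1 b, hlt⟩ := by
      have hcov : SInfty.KCovBy k v (v * SInfty.transp a b) :=
        SInfty.kCovBy_iff_kStep.2 ⟨a, b, ha, hb, rfl, hl⟩
      exact (existsUnique_gen_of_kCovBy hcov).unique he.symm (conj a b)
    refine (main a b ha hb ?_ ?_).1 hl <;> rw [hg]
  · intro h
    have e : g.perm * v = v * SInfty.transp (v.1⁻¹ g.fst) (v.1⁻¹ g.snd) := by
      rw [conj]; simp [Gen.perm]
    refine ⟨v.1⁻¹ g.fst, v.1⁻¹ g.snd, h.1, h.2.1, e, ?_⟩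
    rw [e]
    exact (main _ _ h.1 h.2.1 (by simp) (by simp)).2 h

/-- `Walk k P l Q`: the generators of `l`, applied from left to right, encode a chain of covers of
the `k`-Bruhat order from the permutation `P⁻¹` to the permutation `Q⁻¹`. -/
def Walk (k : ℕ) : Equiv.Perm ℕ+ → GenWord → Equiv.Perm ℕ+ → Prop
  | P, [], Q => P = Q
  | P, g :: l, Q => Cov k P g ∧ Walk k (P * Equiv.swap g.fst g.snd) l Q

theorem walk_append {k : ℕ} {P Q : Equiv.Perm ℕ+} {l m : GenWord} :
    Walk k P (l ++ m) Q ↔ ∃ R, Walk k P l R ∧ Walk k R m Q := by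
  induction l generalizing P with
  | nil => simp [Walk]
  | cons g l ih => simp [Walk, ih, and_assoc]

theorem isMaximalChain_iff_walk {k : ℕ} {u w : SInfty} {x : GenWord} :
    IsMaximalChain k u x w ↔ Walk k u.1⁻¹ x.reverse w.1⁻¹ := by
  have hg : ∀ (g : Gen) (v : SInfty), ((g.perm * v).1)⁻¹ = v.1⁻¹ * Equiv.swap g.fst g.snd := by
    intro g v
    show (Equiv.swap g.fst g.snd * v.1)⁻¹ = _
    simp
  constructor
  · intro h
    induction h with
    | nil => rfl
    | cons g _ hc ih =>
      rw [List.reverse_cons, walk_append]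
      exact ⟨_, ih, kCovBy_iff_cov.1 hc, (hg _ _).symm⟩
  · intro h
    induction x generalizing w with
    | nil =>
      have : u = w := Subtype.ext (inv_injective h)
      subst this
      exact .nil
    | cons g x ih =>
      rw [List.reverse_cons, walk_append] at h
      obtain ⟨R, h1, h2, h3⟩ := h
      have hw : w = g.perm * (g.perm⁻¹ * w) := by group
      have hR : R = ((g.perm⁻¹ * w).1)⁻¹ := by
        rw [hw, hg] at h3
        exact mul_right_cancel h3
      subst hR
      rw [hw]
      exact .cons g (ih h1) (kCovBy_iff_cov.2 h2)

/-! ### The relations (4) and (5) -/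

/-- For (4) with four distinct values, the first cover forces an inequality of positions that blocks
the second. If endpoints coincide, and in (5), some value that has crossed position `k` would have
to cross it again in the same direction. -/
theorem not_walk_of_zeroRel {k : ℕ} {P Q : Equiv.Perm ℕ+} {s : GenWord} (hs : ZeroRel s) :
    ¬ Walk k P s.reverse Q := by
  intro h
  cases hs with
  | @rel4 α β γ δ h₁ h₂ h₃ =>
    obtain ⟨⟨a1, a2, a3⟩, ⟨b1, b2, b3⟩, -⟩ := h
    simp only [Equiv.Perm.mul_apply] at *
    have n1 := h₂.ne
    have n2 := (h₁.trans_lt h₂).ne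
    have n3 := (h₂.trans_le h₃).ne
    have n4 := ((h₁.trans_lt h₂).trans_le h₃).ne
    rcases h₁.eq_or_lt with rfl | h₁
    · rw [Equiv.swap_apply_left] at b1
      omega
    rcases h₃.eq_or_lt with rfl | h₃
    · rw [Equiv.swap_apply_right] at b2
      omega
    rw [Equiv.swap_apply_of_ne_of_ne h₁.ne n4] at b1 b3
    rw [Equiv.swap_apply_of_ne_of_ne n1.symm h₃.ne] at b2 b3
    have b4 := b3 β h₁ h₂
    rw [Equiv.swap_apply_left] at b4
    have a4 := a3 γ h₂ h₃
    have inj := PNat.coe_injective.ne (P.injective.ne h₃.ne)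
    simp only [← PNat.coe_lt_coe] at *
    omega
  | @rel4' α β γ δ h₁ h₂ h₃ =>
    obtain ⟨⟨a1, a2, a3⟩, ⟨b1, b2, b3⟩, -⟩ := h
    simp only [Equiv.Perm.mul_apply] at *
    have n1 := h₂.ne
    have n2 := (h₁.trans_lt h₂).ne
    have n3 := (h₂.trans_le h₃).ne
    have n4 := ((h₁.trans_lt h₂).trans_le h₃).ne
    rcases h₁.eq_or_lt with rfl | h₁
    · rw [Equiv.swap_apply_left] at b1
      omega
    rcases h₃.eq_or_lt with rfl | h₃
    · rw [Equiv.swap_apply_right] at b2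
      omega
    rw [Equiv.swap_apply_of_ne_of_ne h₁.ne' n1] at b1 b3
    rw [Equiv.swap_apply_of_ne_of_ne n4.symm h₃.ne'] at b2 b3
    have b4 := b3 γ h₂ h₃
    rw [Equiv.swap_apply_right] at b4
    have a4 := a3 β h₁ h₂
    have inj := PNat.coe_injective.ne (P.injective.ne h₁.ne)
    simp only [← PNat.coe_lt_coe] at *
    omega
  | @rel5 α β γ h₁ h₂ =>
    obtain ⟨⟨a1, a2, -⟩, -, ⟨-, b2, -⟩, -⟩ := h
    simp only [Equiv.Perm.mul_apply] at *
    rw [Equiv.swap_apply_of_ne_of_ne (h₁.trans h₂).ne' h₂.ne', Equiv.swap_apply_right] at b2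
    omega
  | @rel5' α β γ h₁ h₂ =>
    obtain ⟨⟨a1, a2, -⟩, -, ⟨b1, -, -⟩, -⟩ := h
    simp only [Equiv.Perm.mul_apply] at *
    rw [Equiv.swap_apply_of_ne_of_ne h₁.ne (h₁.trans h₂).ne, Equiv.swap_apply_left] at b1
    omega

theorem IsMaximalChain.not_zeroApplies {k : ℕ} {u w : SInfty} {x : GenWord}
    (hx : IsMaximalChain k u x w) : ¬ ZeroApplies x := by
  rintro ⟨l, s, r, hs, rfl⟩
  rw [isMaximalChain_iff_walk, List.reverse_append, List.reverse_append, walk_append] at hx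
  obtain ⟨R, -, hR⟩ := hx
  obtain ⟨S, hS, -⟩ := walk_append.1 hR
  exact not_walk_of_zeroRel hs hS

/-! ### The relations (1)–(3) carry chains to chains -/

/-- The four endpoints are distinct, so the transpositions commute. The two cover conditions
interact only at each other's endpoints. -/
theorem Walk.swap_comm {k : ℕ} {P Q : Equiv.Perm ℕ+} {g h : Gen} {l : GenWord}
    (H : g.snd < h.fst ∨ h.snd < g.fst ∨ (g.fst < h.fst ∧ h.snd < g.snd) ∨
      (h.fst < g.fst ∧ g.snd < h.snd))
    (hw : Walk k P (g :: h :: l) Q) : Walk k P (h :: g :: l) Q := by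
  obtain ⟨⟨a1, a2, a3⟩, ⟨b1, b2, b3⟩, hl⟩ := hw
  have hg := g.lt
  have hh := h.lt
  have d1 : g.fst ≠ h.fst := by grind
  have d2 : g.fst ≠ h.snd := by grind
  have d3 : g.snd ≠ h.fst := by grind
  have d4 : g.snd ≠ h.snd := by grind
  have c : P * Equiv.swap g.fst g.snd * Equiv.swap h.fst h.snd =
      P * Equiv.swap h.fst h.snd * Equiv.swap g.fst g.snd := by
    rw [mul_assoc, mul_assoc]
    congr 1
    ext x
    simp only [Equiv.Perm.mul_apply, Equiv.swap_apply_def]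
    grind
  rw [c] at hl
  simp only [Equiv.Perm.mul_apply] at *
  rw [Equiv.swap_apply_of_ne_of_ne d1.symm d3.symm] at b1 b3
  rw [Equiv.swap_apply_of_ne_of_ne d2.symm d4.symm] at b2 b3
  have swaps : ∀ a b x : ℕ+, Equiv.swap a b x = a ∧ x = b ∨ Equiv.swap a b x = b ∧ x = a ∨
      Equiv.swap a b x = x ∧ x ≠ a ∧ x ≠ b := by
    intro a b x
    rw [Equiv.swap_apply_def]
    split_ifs <;> simp_all
  have b4 := b3 g.fst
  have b5 := b3 g.snd
  rw [Equiv.swap_apply_left] at b4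
  rw [Equiv.swap_apply_right] at b5
  have a4 := a3 h.fst
  have a5 := a3 h.snd
  refine ⟨⟨b1, b2, fun x h1 h2 => ?_⟩, ⟨?_, ?_, fun x h1 h2 => ?_⟩, hl⟩
  · rcases eq_or_ne x g.fst with rfl | e1
    · simp only [← PNat.coe_lt_coe] at *
      omega
    rcases eq_or_ne x g.snd with rfl | e2
    · simp only [← PNat.coe_lt_coe] at *
      omega
    have := b3 x h1 h2
    rwa [Equiv.swap_apply_of_ne_of_ne e1 e2] at this
  · rwa [Equiv.Perm.mul_apply, Equiv.swap_apply_of_ne_of_ne d1 d2]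
  · rwa [Equiv.Perm.mul_apply, Equiv.swap_apply_of_ne_of_ne d3 d4]
  · simp only [Equiv.Perm.mul_apply]
    rw [Equiv.swap_apply_of_ne_of_ne d1 d2, Equiv.swap_apply_of_ne_of_ne d3 d4]
    have a6 := a3 x h1 h2
    rcases swaps h.fst h.snd x with ⟨e, e'⟩ | ⟨e, e'⟩ | ⟨e, -⟩ <;> rw [e]
    · subst e'
      simp only [← PNat.coe_lt_coe] at *
      omega
    · subst e'
      simp only [← PNat.coe_lt_coe] at *
      omega
    · exact a6

set_option linter.unusedSimpArgs false in
theorem walk_rel1 {k : ℕ} {P Q : Equiv.Perm ℕ+} {l : GenWord} {α β γ δ : ℕ+} (h₁ : α < β)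
    (h₂ : β < γ) (h₃ : γ < δ)
    (hw : Walk k P (⟨α, γ, h₁.trans h₂⟩ :: ⟨γ, δ, h₃⟩ :: ⟨β, γ, h₂⟩ :: l) Q) :
    Walk k P (⟨β, γ, h₂⟩ :: ⟨α, β, h₁⟩ :: ⟨β, δ, h₂.trans h₃⟩ :: l) Q := by
  obtain ⟨⟨a1, a2, a3⟩, ⟨b1, b2, b3⟩, ⟨c1, c2, c3⟩, h⟩ := hw
  have c : P * Equiv.swap α γ * Equiv.swap γ δ * Equiv.swap β γ =
      P * Equiv.swap β γ * Equiv.swap α β * Equiv.swap β δ := by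
    simp only [mul_assoc]
    congr 1
    ext x
    simp only [Equiv.Perm.mul_apply, Equiv.swap_apply_def]
    grind
  have n1 := h₁.ne
  have n2 := h₂.ne
  have n3 := h₃.ne
  have n4 := (h₁.trans h₂).ne
  have n5 := (h₂.trans h₃).ne
  have n6 := (h₁.trans (h₂.trans h₃)).ne
  have inj : ∀ {x y : ℕ+}, x ≠ y → (P x : ℕ) ≠ P y :=
    fun n => PNat.coe_injective.ne (P.injective.ne n)
  simp only [Equiv.Perm.mul_apply, Equiv.swap_apply_def, n1, n2, n3, n4, n5, n6, n1.symm, n2.symm,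
    n3.symm, n4.symm, n5.symm, n6.symm, if_true, if_false] at a1 a2 a3 b1 b2 b3 c1 c2 c3
  simp only [← PNat.coe_lt_coe] at h₁ h₂ h₃ a3 b3 c3
  -- The third cover needs `P β ≤ k`, so the first cover, whose interval contains `β`, forces `P β <
  -- P α`.
  have hβ := a3 β h₁ h₂
  have hβ' := inj n1
  refine ⟨?_, ?_, ?_, c ▸ h⟩
  · refine ⟨?_, ?_, fun x hx hy => ?_⟩
    · simp only [Equiv.Perm.mul_apply, Equiv.swap_apply_def, n1, n1.symm, n2, n2.symm, n3,
        n3.symm, n4, n4.symm, n5, n5.symm, n6, n6.symm, if_true, if_false, ← PNat.coe_lt_coe]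
      omega
    · simp only [Equiv.Perm.mul_apply, Equiv.swap_apply_def, n1, n1.symm, n2, n2.symm, n3,
        n3.symm, n4, n4.symm, n5, n5.symm, n6, n6.symm, if_true, if_false, ← PNat.coe_lt_coe]
      omega
    · simp only [← PNat.coe_lt_coe] at hx hy
      have e1 : x ≠ α := by rintro rfl; omega
      have e2 : x ≠ β := by rintro rfl; omega
      have e3 : x ≠ γ := by rintro rfl; omega
      have e4 : x ≠ δ := by rintro rfl; omega
      have f1 := a3 x
      have f3 := c3 x
      simp only [Equiv.Perm.mul_apply, Equiv.swap_apply_def, e1, e2, e3, e4, n1, n1.symm, n2,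
        n2.symm, n3, n3.symm, n4, n4.symm, n5, n5.symm, n6, n6.symm, if_true, if_false,
        ← PNat.coe_lt_coe] at f1 f3 ⊢
      have i1 := inj e1
      have i2 := inj e2
      have i3 := inj e3
      have i4 := inj e4
      omega
  · refine ⟨?_, ?_, fun x hx hy => ?_⟩
    · simp only [Equiv.Perm.mul_apply, Equiv.swap_apply_def, n1, n1.symm, n2, n2.symm, n3,
        n3.symm, n4, n4.symm, n5, n5.symm, n6, n6.symm, if_true, if_false, ← PNat.coe_lt_coe]
      omega
    · simp only [Equiv.Perm.mul_apply, Equiv.swap_apply_def, n1, n1.symm, n2, n2.symm, n3,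
        n3.symm, n4, n4.symm, n5, n5.symm, n6, n6.symm, if_true, if_false, ← PNat.coe_lt_coe]
      omega
    · simp only [← PNat.coe_lt_coe] at hx hy
      have e1 : x ≠ α := by rintro rfl; omega
      have e2 : x ≠ β := by rintro rfl; omega
      have e3 : x ≠ γ := by rintro rfl; omega
      have e4 : x ≠ δ := by rintro rfl; omega
      have f1 := a3 x
      simp only [Equiv.Perm.mul_apply, Equiv.swap_apply_def, e1, e2, e3, e4, n1, n1.symm, n2,
        n2.symm, n3, n3.symm, n4, n4.symm, n5, n5.symm, n6, n6.symm, if_true, if_false,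
        ← PNat.coe_lt_coe] at f1 ⊢
      have i1 := inj e1
      have i2 := inj e2
      have i3 := inj e3
      have i4 := inj e4
      omega
  · refine ⟨?_, ?_, fun x hx hy => ?_⟩
    · simp only [Equiv.Perm.mul_apply, Equiv.swap_apply_def, n1, n1.symm, n2, n2.symm, n3,
        n3.symm, n4, n4.symm, n5, n5.symm, n6, n6.symm, if_true, if_false, ← PNat.coe_lt_coe]
      omega
    · simp only [Equiv.Perm.mul_apply, Equiv.swap_apply_def, n1, n1.symm, n2, n2.symm, n3,
        n3.symm, n4, n4.symm, n5, n5.symm, n6, n6.symm, if_true, if_false, ← PNat.coe_lt_coe]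
      omega
    · simp only [← PNat.coe_lt_coe] at hx hy
      -- The interval from `β` to `δ` belongs to no given cover: below `γ` the third cover applies,
      -- above `γ` the second.
      rcases lt_trichotomy (x : ℕ) γ with t | t | t
      · have e1 : x ≠ α := by rintro rfl; omega
        have e2 : x ≠ β := by rintro rfl; omega
        have e3 : x ≠ γ := by rintro rfl; omega
        have e4 : x ≠ δ := by rintro rfl; omega
        have f3 := c3 x
        simp only [Equiv.Perm.mul_apply, Equiv.swap_apply_def, e1, e2, e3, e4, n1, n1.symm, n2,
          n2.symm, n3, n3.symm, n4, n4.symm, n5, n5.symm, n6, n6.symm, if_true, if_false,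
          ← PNat.coe_lt_coe] at f3 ⊢
        have i1 := inj e1
        have i2 := inj e2
        have i3 := inj e3
        have i4 := inj e4
        omega
      · obtain rfl : x = γ := PNat.coe_injective t
        simp only [Equiv.Perm.mul_apply, Equiv.swap_apply_def, n1, n1.symm, n2, n2.symm, n3,
          n3.symm, n4, n4.symm, n5, n5.symm, n6, n6.symm, if_true, if_false, ← PNat.coe_lt_coe]
        omega
      · have e1 : x ≠ α := by rintro rfl; omega
        have e2 : x ≠ β := by rintro rfl; omega
        have e3 : x ≠ γ := by rintro rfl; omega
        have e4 : x ≠ δ := by rintro rfl; omega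
        have f2 := b3 x
        simp only [Equiv.Perm.mul_apply, Equiv.swap_apply_def, e1, e2, e3, e4, n1, n1.symm, n2,
          n2.symm, n3, n3.symm, n4, n4.symm, n5, n5.symm, n6, n6.symm, if_true, if_false,
          ← PNat.coe_lt_coe] at f2 ⊢
        have i1 := inj e1
        have i2 := inj e2
        have i3 := inj e3
        have i4 := inj e4
        omega

set_option linter.unusedSimpArgs false in
theorem walk_rel2 {k : ℕ} {P Q : Equiv.Perm ℕ+} {l : GenWord} {α β γ δ : ℕ+} (h₁ : α < β)
    (h₂ : β < γ) (h₃ : γ < δ)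
    (hw : Walk k P (⟨β, δ, h₂.trans h₃⟩ :: ⟨α, β, h₁⟩ :: ⟨β, γ, h₂⟩ :: l) Q) :
    Walk k P (⟨β, γ, h₂⟩ :: ⟨γ, δ, h₃⟩ :: ⟨α, γ, h₁.trans h₂⟩ :: l) Q := by
  obtain ⟨⟨a1, a2, a3⟩, ⟨b1, b2, b3⟩, ⟨c1, c2, c3⟩, h⟩ := hw
  have c : P * Equiv.swap β δ * Equiv.swap α β * Equiv.swap β γ =
      P * Equiv.swap β γ * Equiv.swap γ δ * Equiv.swap α γ := by
    simp only [mul_assoc]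
    congr 1
    ext x
    simp only [Equiv.Perm.mul_apply, Equiv.swap_apply_def]
    grind
  have n1 := h₁.ne
  have n2 := h₂.ne
  have n3 := h₃.ne
  have n4 := (h₁.trans h₂).ne
  have n5 := (h₂.trans h₃).ne
  have n6 := (h₁.trans (h₂.trans h₃)).ne
  have inj : ∀ {x y : ℕ+}, x ≠ y → (P x : ℕ) ≠ P y :=
    fun n => PNat.coe_injective.ne (P.injective.ne n)
  simp only [Equiv.Perm.mul_apply, Equiv.swap_apply_def, n1, n2, n3, n4, n5, n6, n1.symm, n2.symm,
    n3.symm, n4.symm, n5.symm, n6.symm, if_true, if_false] at a1 a2 a3 b1 b2 b3 c1 c2 c3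
  simp only [← PNat.coe_lt_coe] at h₁ h₂ h₃ a3 b3 c3
  -- The third cover needs `k < P γ`, so the first cover forces `P δ < P γ`.
  have hγ := a3 γ h₂ h₃
  have hγ' := inj n3
  refine ⟨?_, ?_, ?_, c ▸ h⟩
  · refine ⟨?_, ?_, fun x hx hy => ?_⟩
    · simp only [Equiv.Perm.mul_apply, Equiv.swap_apply_def, n1, n1.symm, n2, n2.symm, n3,
        n3.symm, n4, n4.symm, n5, n5.symm, n6, n6.symm, if_true, if_false, ← PNat.coe_lt_coe]
      omega
    · simp only [Equiv.Perm.mul_apply, Equiv.swap_apply_def, n1, n1.symm, n2, n2.symm, n3,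
        n3.symm, n4, n4.symm, n5, n5.symm, n6, n6.symm, if_true, if_false, ← PNat.coe_lt_coe]
      omega
    · simp only [← PNat.coe_lt_coe] at hx hy
      have e1 : x ≠ α := by rintro rfl; omega
      have e2 : x ≠ β := by rintro rfl; omega
      have e3 : x ≠ γ := by rintro rfl; omega
      have e4 : x ≠ δ := by rintro rfl; omega
      have f1 := a3 x
      have f3 := c3 x
      simp only [Equiv.Perm.mul_apply, Equiv.swap_apply_def, e1, e2, e3, e4, n1, n1.symm, n2,
        n2.symm, n3, n3.symm, n4, n4.symm, n5, n5.symm, n6, n6.symm, if_true, if_false,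
        ← PNat.coe_lt_coe] at f1 f3 ⊢
      have i1 := inj e1
      have i2 := inj e2
      have i3 := inj e3
      have i4 := inj e4
      omega
  · refine ⟨?_, ?_, fun x hx hy => ?_⟩
    · simp only [Equiv.Perm.mul_apply, Equiv.swap_apply_def, n1, n1.symm, n2, n2.symm, n3,
        n3.symm, n4, n4.symm, n5, n5.symm, n6, n6.symm, if_true, if_false, ← PNat.coe_lt_coe]
      omega
    · simp only [Equiv.Perm.mul_apply, Equiv.swap_apply_def, n1, n1.symm, n2, n2.symm, n3,
        n3.symm, n4, n4.symm, n5, n5.symm, n6, n6.symm, if_true, if_false, ← PNat.coe_lt_coe]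
      omega
    · simp only [← PNat.coe_lt_coe] at hx hy
      have e1 : x ≠ α := by rintro rfl; omega
      have e2 : x ≠ β := by rintro rfl; omega
      have e3 : x ≠ γ := by rintro rfl; omega
      have e4 : x ≠ δ := by rintro rfl; omega
      have f1 := a3 x
      simp only [Equiv.Perm.mul_apply, Equiv.swap_apply_def, e1, e2, e3, e4, n1, n1.symm, n2,
        n2.symm, n3, n3.symm, n4, n4.symm, n5, n5.symm, n6, n6.symm, if_true, if_false,
        ← PNat.coe_lt_coe] at f1 ⊢
      have i1 := inj e1
      have i2 := inj e2
      have i3 := inj e3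
      have i4 := inj e4
      omega
  · refine ⟨?_, ?_, fun x hx hy => ?_⟩
    · simp only [Equiv.Perm.mul_apply, Equiv.swap_apply_def, n1, n1.symm, n2, n2.symm, n3,
        n3.symm, n4, n4.symm, n5, n5.symm, n6, n6.symm, if_true, if_false, ← PNat.coe_lt_coe]
      omega
    · simp only [Equiv.Perm.mul_apply, Equiv.swap_apply_def, n1, n1.symm, n2, n2.symm, n3,
        n3.symm, n4, n4.symm, n5, n5.symm, n6, n6.symm, if_true, if_false, ← PNat.coe_lt_coe]
      omega
    · simp only [← PNat.coe_lt_coe] at hx hy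
      -- Below `β` the second given cover applies, above `β` the third.
      rcases lt_trichotomy (x : ℕ) β with t | t | t
      · have e1 : x ≠ α := by rintro rfl; omega
        have e2 : x ≠ β := by rintro rfl; omega
        have e3 : x ≠ γ := by rintro rfl; omega
        have e4 : x ≠ δ := by rintro rfl; omega
        have f2 := b3 x
        simp only [Equiv.Perm.mul_apply, Equiv.swap_apply_def, e1, e2, e3, e4, n1, n1.symm, n2,
          n2.symm, n3, n3.symm, n4, n4.symm, n5, n5.symm, n6, n6.symm, if_true, if_false,
          ← PNat.coe_lt_coe] at f2 ⊢
        have i1 := inj e1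
        have i2 := inj e2
        have i3 := inj e3
        have i4 := inj e4
        omega
      · obtain rfl : x = β := PNat.coe_injective t
        simp only [Equiv.Perm.mul_apply, Equiv.swap_apply_def, n1, n1.symm, n2, n2.symm, n3,
          n3.symm, n4, n4.symm, n5, n5.symm, n6, n6.symm, if_true, if_false, ← PNat.coe_lt_coe]
        omega
      · have e1 : x ≠ α := by rintro rfl; omega
        have e2 : x ≠ β := by rintro rfl; omega
        have e3 : x ≠ γ := by rintro rfl; omega
        have e4 : x ≠ δ := by rintro rfl; omega
        have f3 := c3 x
        simp only [Equiv.Perm.mul_apply, Equiv.swap_apply_def, e1, e2, e3, e4, n1, n1.symm, n2,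
          n2.symm, n3, n3.symm, n4, n4.symm, n5, n5.symm, n6, n6.symm, if_true, if_false,
          ← PNat.coe_lt_coe] at f3 ⊢
        have i1 := inj e1
        have i2 := inj e2
        have i3 := inj e3
        have i4 := inj e4
        omega

/-! ### The criterion for the `k`-Bruhat order -/

/-- The criterion for `P⁻¹ ≤_k Q⁻¹`, where `P` and `Q` are the position functions of the two
permutations and `ζ = Q⁻¹ * P`. -/
structure Admissible (k : ℕ) (P ζ : Equiv.Perm ℕ+) : Prop where
  low : ∀ x, (P x : ℕ) ≤ k → x ≤ ζ x
  high : ∀ x, k < (P x : ℕ) → ζ x ≤ x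
  mono : ∀ x y, x < y → P x < P y → ((P x : ℕ) ≤ k ↔ (P y : ℕ) ≤ k) → ζ x < ζ y

/-- Only comparisons with `α` or `β` change. One that is not inherited would involve a value between
`α` and `β` at an intermediate position, which the cover forbids. -/
theorem Admissible.of_cov {k : ℕ} {P ζ : Equiv.Perm ℕ+} {g : Gen} (hc : Cov k P g)
    (h : Admissible k (P * Equiv.swap g.fst g.snd) (ζ * Equiv.swap g.fst g.snd)) :
    Admissible k P ζ := by
  obtain ⟨α, β, hab⟩ := g
  obtain ⟨c1, c2, c3⟩ := hc
  obtain ⟨h1, h2, h3⟩ := h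
  simp only [Equiv.Perm.mul_apply] at *
  have ev : ∀ x, x ≠ α → x ≠ β → Equiv.swap α β x = x :=
    fun x => Equiv.swap_apply_of_ne_of_ne
  refine ⟨fun x hx => ?_, fun x hx => ?_, fun x y hxy hP hs => ?_⟩
  · rcases eq_or_ne x α with rfl | e1
    · have := h1 β
      rw [Equiv.swap_apply_right] at this
      exact hab.le.trans (this hx)
    rcases eq_or_ne x β with rfl | e2
    · omega
    · have := h1 x
      rw [ev x e1 e2] at this
      exact this hx
  · rcases eq_or_ne x α with rfl | e1
    · omega
    rcases eq_or_ne x β with rfl | e2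
    · have := h2 α
      rw [Equiv.swap_apply_left] at this
      exact (this hx).trans hab.le
    · have := h2 x
      rw [ev x e1 e2] at this
      exact this hx
  · rcases eq_or_ne x α with rfl | e1
    · have e1 := hxy.ne'
      have e2 : y ≠ β := by rintro rfl; omega
      rcases lt_or_gt_of_ne e2 with l | l
      · refine absurd ⟨hP, ?_⟩ (c3 y hxy l)
        rw [← PNat.coe_lt_coe]; omega
      · have := h3 β y l
        rw [Equiv.swap_apply_right, ev y e1 e2] at this
        exact this hP hs
    rcases eq_or_ne x β with rfl | e2
    · have := h3 α y (hab.trans hxy)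
      rw [Equiv.swap_apply_left, ev y (hab.trans hxy).ne' hxy.ne'] at this
      exact this hP hs
    rcases eq_or_ne y α with rfl | e3
    · have := h3 x β (hxy.trans hab)
      rw [Equiv.swap_apply_right, ev x e1 e2] at this
      exact this hP hs
    rcases eq_or_ne y β with rfl | e4
    · rcases lt_or_gt_of_ne e1 with l | l
      · have := h3 x α l
        rw [Equiv.swap_apply_left, ev x e1 e2] at this
        exact this hP hs
      · refine absurd ⟨?_, hP⟩ (c3 x l hxy)
        rw [← PNat.coe_lt_coe]; omega
    · have := h3 x y hxy
      rw [ev x e1 e2, ev y e3 e4] at this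
      exact this hP hs

/-- The step exchanges the positions of `α` and `β`, which creates new non-inversions with the
values between them; `hx` is what `mono` demands of these. Through the old `mono`, `hx` also
excludes any value that would block the cover. -/
theorem Admissible.step {k : ℕ} {P ζ : Equiv.Perm ℕ+} (h : Admissible k P ζ) {α β : ℕ+}
    (hab : α < β) (hα : β ≤ ζ α) (hβ : ζ β ≤ α)
    (hx : ∀ x, α < x → x < β → ((P x : ℕ) ≤ k → ζ x < ζ α) ∧ (k < (P x : ℕ) → ζ β < ζ x)) :
    Cov k P ⟨α, β, hab⟩ ∧ Admissible k (P * Equiv.swap α β) (ζ * Equiv.swap α β) := by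
  obtain ⟨h1, h2, h3⟩ := h
  have c1 : (P α : ℕ) ≤ k := by
    by_contra! hk
    exact absurd (hab.trans_le hα) (h2 α hk).not_gt
  have c2 : k < (P β : ℕ) := by
    by_contra! hk
    exact absurd (hβ.trans_lt hab) (h1 β hk).not_gt
  have ev : ∀ x, x ≠ α → x ≠ β → Equiv.swap α β x = x :=
    fun x => Equiv.swap_apply_of_ne_of_ne
  refine ⟨⟨c1, c2, ?_⟩, ?_, ?_, ?_⟩
  · rintro x l1 l2 ⟨p1, p2⟩
    rcases le_or_gt (P x : ℕ) k with hk | hk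
    · exact (h3 α x l1 p1 (by omega)).not_gt ((hx x l1 l2).1 hk)
    · exact (h3 x β l2 p2 (by omega)).not_gt ((hx x l1 l2).2 hk)
  · intro x hk
    simp only [Equiv.Perm.mul_apply] at *
    rcases eq_or_ne x α with rfl | e1
    · rw [Equiv.swap_apply_left] at hk
      omega
    rcases eq_or_ne x β with rfl | e2
    · rwa [Equiv.swap_apply_right]
    · rw [ev x e1 e2] at hk ⊢
      exact h1 x hk
  · intro x hk
    simp only [Equiv.Perm.mul_apply] at *
    rcases eq_or_ne x α with rfl | e1
    · rwa [Equiv.swap_apply_left]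
    rcases eq_or_ne x β with rfl | e2
    · rw [Equiv.swap_apply_right] at hk
      omega
    · rw [ev x e1 e2] at hk ⊢
      exact h2 x hk
  · intro x y hxy hP hs
    simp only [Equiv.Perm.mul_apply] at hP hs ⊢
    rcases eq_or_ne x α with rfl | e1
    · rw [Equiv.swap_apply_left] at hP hs ⊢
      rcases eq_or_ne y β with rfl | e2
      · rw [Equiv.swap_apply_right]
        exact (hβ.trans_lt hab).trans_le hα
      rw [ev y hxy.ne' e2] at hP hs ⊢
      rcases lt_or_gt_of_ne e2 with l | l
      · exact (hx y hxy l).2 (by omega)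
      · exact h3 β y l hP hs
    rcases eq_or_ne x β with rfl | e2
    · rw [Equiv.swap_apply_right, ev y (hab.trans hxy).ne' hxy.ne'] at hP hs ⊢
      exact h3 α y (hab.trans hxy) hP hs
    rw [ev x e1 e2] at hP hs ⊢
    rcases eq_or_ne y α with rfl | e3
    · rw [Equiv.swap_apply_left] at hP hs ⊢
      exact h3 x β (hxy.trans hab) hP hs
    rcases eq_or_ne y β with rfl | e4
    · rw [Equiv.swap_apply_right] at hP hs ⊢
      rcases lt_or_gt_of_ne e1 with l | l
      · exact h3 x α l hP hs
      · exact (hx x l hxy).1 (by omega)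
    · rw [ev y e3 e4] at hP hs ⊢
      exact h3 x y hxy hP hs

theorem Admissible.step_of_fixed {k : ℕ} {P ζ : Equiv.Perm ℕ+} (h : Admissible k P ζ) {α β : ℕ+}
    (hab : α < β) (hα : β ≤ ζ α) (hβ : ζ β ≤ α) (hx : ∀ x, α < x → x < β → ζ x = x) :
    Cov k P ⟨α, β, hab⟩ ∧ Admissible k (P * Equiv.swap α β) (ζ * Equiv.swap α β) := by
  refine h.step hab hα hβ fun x l1 l2 => ?_
  rw [hx x l1 l2]
  exact ⟨fun _ => l2.trans_le hα, fun _ => hβ.trans_lt l1⟩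

theorem admissible_one (k : ℕ) (P : Equiv.Perm ℕ+) : Admissible k P 1 :=
  ⟨fun _ _ => le_rfl, fun _ _ => le_rfl, fun _ _ h _ _ => h⟩

theorem Walk.admissible {k : ℕ} {P Q : Equiv.Perm ℕ+} {l : GenWord} (h : Walk k P l Q) :
    Admissible k P (Q⁻¹ * P) := by
  induction l generalizing P with
  | nil =>
    obtain rfl : P = Q := h
    rw [inv_mul_cancel]
    exact admissible_one k P
  | cons g l ih =>
    have := ih h.2
    rw [← mul_assoc] at this
    exact .of_cov h.1 this

/-! ### The canonical first cover -/

/-- The source of the existence claims below: if the desired value were missing, some finite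
interval would be stable under `ζ`, although a value outside it is sent into it. -/
theorem Equiv.Perm.mem_of_apply_mem_finset {X : Type*} (f : Equiv.Perm X) {s : Finset X}
    (h : ∀ x ∈ s, f x ∈ s) {x : X} (hx : f x ∈ s) : x ∈ s := by
  obtain ⟨y, hy, e⟩ := Finset.surjOn_of_injOn_of_card_le f (s := s) (t := s) h
    f.injective.injOn le_rfl hx
  exact f.injective e ▸ hy

/-- A transposition `(α β)` that starts a chain below `ζ` canonically: `α` is the largest value
raised by `ζ`, and `β` is the least value above `α` that `ζ` moves to or below `α`. -/
structure IsTopCover (ζ : Equiv.Perm ℕ+) (α β : ℕ+) : Prop where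
  lt : α < β
  le_apply : β ≤ ζ α
  apply_le : ζ β ≤ α
  top : ∀ x, α < x → ζ x ≤ x
  fixed : ∀ x, α < x → x < β → ζ x = x

theorem PNat.exists_max_of_finite {p : ℕ+ → Prop} (hp : {x | p x}.Finite) (h : ∃ x, p x) :
    ∃ m, p m ∧ ∀ x, p x → x ≤ m := by
  obtain ⟨m, hm, hmax⟩ := hp.exists_maximal h
  exact ⟨m, hm, fun x hx => (le_total x m).elim id fun h => hmax hx h⟩

theorem PNat.exists_min {p : ℕ+ → Prop} (h : ∃ x, p x) : ∃ m, p m ∧ ∀ x, p x → m ≤ x := by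
  obtain ⟨m, hm, hmin⟩ := wellFounded_lt.has_min {x | p x} h
  exact ⟨m, hm, fun x hx => not_lt.1 (hmin x hx)⟩

theorem exists_isTopCover {ζ : Equiv.Perm ℕ+} (hf : ζ ∈ SInfty) (h1 : ζ ≠ 1) :
    ∃ α β, IsTopCover ζ α β := by
  obtain ⟨α, hα, hmax⟩ : ∃ α, α < ζ α ∧ ∀ x, x < ζ x → x ≤ α := by
    refine PNat.exists_max_of_finite (hf.subset fun x hx => ne_of_gt hx) ?_
    by_contra! hle
    refine h1 (Equiv.ext fun x => (hle x).antisymm (not_lt.1 fun hlt => ?_))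
    have := ζ.mem_of_apply_mem_finset (s := Finset.Iio x)
      (fun y hy => Finset.mem_Iio.2 ((hle y).trans_lt (Finset.mem_Iio.1 hy)))
      (Finset.mem_Iio.2 hlt)
    simp at this
  have top : ∀ x, α < x → ζ x ≤ x := fun x hx => not_lt.1 fun h => hx.not_ge (hmax x h)
  have ex : ∃ β, (α < β ∧ β ≤ ζ α) ∧ ζ β ≤ α := by
    by_contra! hno
    have := ζ.mem_of_apply_mem_finset (s := Finset.Ioc α (ζ α)) (x := α)
      (fun y hy => by
        rw [Finset.mem_Ioc] at hy ⊢
        exact ⟨hno y hy, (top y hy.1).trans hy.2⟩)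
      (by simpa using hα)
    simp at this
  obtain ⟨β, ⟨⟨hab, hle⟩, hβ⟩, hmin⟩ := PNat.exists_min ex
  refine ⟨α, β, hab, hle, hβ, top, fun x l1 l2 => (top x l1).antisymm (not_lt.1 fun hlt => ?_)⟩
  have above : ∀ y, α < y → y < β → α < ζ y := fun y m1 m2 => not_le.1 fun hy =>
    m2.not_ge (hmin y ⟨⟨m1, m2.le.trans hle⟩, hy⟩)
  have := ζ.mem_of_apply_mem_finset (s := Finset.Ioo α x) (x := x)
    (fun y hy => by
      rw [Finset.mem_Ioo] at hy ⊢
      exact ⟨above y hy.1 (hy.2.trans l2), (top y hy.1).trans_lt hy.2⟩)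
    (by simpa using ⟨above x l1 l2, hlt⟩)
  simp at this

theorem SInfty.mul_swap_mem {ζ : Equiv.Perm ℕ+} (hf : ζ ∈ SInfty) (α β : ℕ+) :
    ζ * Equiv.swap α β ∈ SInfty :=
  SInfty.mul_mem hf (SInfty.transp α β).2

/-- Peel off top covers; the values between `α` and `β` are fixed, so each such step preserves
admissibility. -/
theorem Admissible.exists_walk {k : ℕ} {P Q : Equiv.Perm ℕ+} (h : Admissible k P (Q⁻¹ * P))
    (hf : Q⁻¹ * P ∈ SInfty) : ∃ l, Walk k P l Q := by
  obtain ⟨N, hN⟩ := Set.Finite.bddAbove hf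
  replace hN : ∀ x, N < x → (Q⁻¹ * P) x = x := fun x hx => by
    by_contra hne
    exact absurd (hN hne) (not_le.2 hx)
  -- The measure is the total rise: truncated subtraction makes lowered values count zero. A step
  -- changes the joint contribution of `α` and `β` from `ζ α - α` to `ζ α - β`.
  induction hn : ∑ x ∈ Finset.Icc 1 N, (((Q⁻¹ * P) x : ℕ) - x) using Nat.strong_induction_on
    generalizing P with
  | _ n ih =>
    by_cases h1 : Q⁻¹ * P = 1
    · exact ⟨[], (inv_mul_eq_one.1 h1).symm⟩
    obtain ⟨α, β, t⟩ := exists_isTopCover hf h1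
    obtain ⟨hc, ha⟩ := h.step_of_fixed t.lt t.le_apply t.apply_le t.fixed
    have hne : ∀ x, (Q⁻¹ * P) x ≠ x → x ≤ N := fun x hx => not_lt.1 fun h => hx (hN x h)
    have hαN : α ≤ N := hne α (t.lt.trans_le t.le_apply).ne'
    have hβN : β ≤ N := hne β (t.apply_le.trans_lt t.lt).ne
    rw [mul_assoc] at ha
    have hs := mul_assoc Q⁻¹ P (Equiv.swap α β)
    set ζ := Q⁻¹ * P with hζ
    have hlt : ∑ x ∈ Finset.Icc 1 N, (((Q⁻¹ * (P * Equiv.swap α β)) x : ℕ) - x) < n := by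
      rw [← hn, ← hs]
      have hα' : α ∈ Finset.Icc 1 N := by simp [hαN]
      have hβ' : β ∈ (Finset.Icc 1 N).erase α := by simp [hβN, t.lt.ne']
      rw [← Finset.add_sum_erase _ _ hα', ← Finset.add_sum_erase _ _ hβ',
        ← Finset.add_sum_erase _ _ hα', ← Finset.add_sum_erase _ _ hβ']
      have e : ∑ x ∈ ((Finset.Icc 1 N).erase α).erase β,
          (((ζ * Equiv.swap α β) x : ℕ) - x) =
          ∑ x ∈ ((Finset.Icc 1 N).erase α).erase β, ((ζ x : ℕ) - x) := by
        refine Finset.sum_congr rfl fun x hx => ?_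
        simp only [Finset.mem_erase] at hx
        rw [Equiv.Perm.mul_apply, Equiv.swap_apply_of_ne_of_ne hx.2.1 hx.1]
      rw [e]
      simp only [Equiv.Perm.mul_apply, Equiv.swap_apply_left, Equiv.swap_apply_right]
      obtain ⟨t1, t2, t3, -, -⟩ := t
      simp only [← PNat.coe_lt_coe, ← PNat.coe_le_coe] at t1 t2 t3
      omega
    have hfix : ∀ x, N < x → (Q⁻¹ * (P * Equiv.swap α β)) x = x := fun x hx => by
      rw [← hs, Equiv.Perm.mul_apply,
        Equiv.swap_apply_of_ne_of_ne (hαN.trans_lt hx).ne' (hβN.trans_lt hx).ne', hN x hx]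
    obtain ⟨l, hl⟩ := ih _ hlt ha (hs ▸ SInfty.mul_swap_mem hf α β) hfix rfl
    exact ⟨⟨α, β, t.lt⟩ :: l, hc, hl⟩

theorem Walk.cons {k : ℕ} {P Q : Equiv.Perm ℕ+} {g : Gen} {l : GenWord} (hc : Cov k P g)
    (h : Walk k (P * Equiv.swap g.fst g.snd) l Q) : Walk k P (g :: l) Q :=
  ⟨hc, h⟩

/-! ### Linked chains -/

/-- Two words, read from left to right, are joined by braid moves through chains from `P⁻¹` to
`Q⁻¹`. -/
def Linked (k : ℕ) (P Q : Equiv.Perm ℕ+) : GenWord → GenWord → Prop :=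
  Relation.ReflTransGen fun x y =>
    BraidMove x.reverse y.reverse ∧ Walk k P x Q ∧ Walk k P y Q

theorem BraidMove.symm {x y : GenWord} (h : BraidMove x y) : BraidMove y x := by
  obtain ⟨l, s, t, r, hst, hx, hy⟩ := h
  exact ⟨l, t, s, r, hst.symm, hy, hx⟩

theorem BraidMove.length_eq {x y : GenWord} (h : BraidMove x y) : x.length = y.length := by
  obtain ⟨l, s, t, r, hst, rfl, rfl⟩ := h
  have : s.length = t.length := by rcases hst with h | h <;> cases h <;> rfl
  simp [this]

theorem BraidMove.append_singleton {x y : GenWord} (h : BraidMove x y) (g : Gen) :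
    BraidMove (x ++ [g]) (y ++ [g]) := by
  obtain ⟨l, s, t, r, hst, rfl, rfl⟩ := h
  exact ⟨l, s, t, r ++ [g], hst, by simp, by simp⟩

theorem BraidRel.braidMove_reverse_append {s t : GenWord} (h : BraidRel s.reverse t.reverse)
    (l : GenWord) : BraidMove (s ++ l).reverse (t ++ l).reverse :=
  ⟨l.reverse, s.reverse, t.reverse, [], Or.inl h, by simp, by simp⟩

namespace Linked

variable {k : ℕ} {P Q : Equiv.Perm ℕ+} {x y z : GenWord} {g h : Gen}

theorem symm (H : Linked k P Q x y) : Linked k P Q y x :=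
  by
  induction H with
  | refl => exact .refl
  | tail _ h ih => exact .head ⟨h.1.symm, h.2.2, h.2.1⟩ ih

theorem trans (H : Linked k P Q x y) (H' : Linked k P Q y z) : Linked k P Q x z :=
  Relation.ReflTransGen.trans H H'

theorem length_eq (H : Linked k P Q x y) : x.length = y.length := by
  induction H with
  | refl => rfl
  | tail _ h ih => rw [ih]; simpa using h.1.length_eq

theorem walk (H : Linked k P Q x y) (hx : Walk k P x Q) : Walk k P y Q := by
  rcases Relation.ReflTransGen.cases_tail H with rfl | ⟨_, -, h⟩
  · exact hx
  · exact h.2.2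

theorem cons (hc : Cov k P g) (H : Linked k (P * Equiv.swap g.fst g.snd) Q x y) :
    Linked k P Q (g :: x) (g :: y) := by
  refine Relation.ReflTransGen.lift (g :: ·) ?_ _ _ H
  rintro a b ⟨h1, h2, h3⟩
  refine ⟨?_, ⟨hc, h2⟩, ⟨hc, h3⟩⟩
  simpa using h1.append_singleton g

theorem swap_comm (H : g.snd < h.fst ∨ h.snd < g.fst ∨ (g.fst < h.fst ∧ h.snd < g.snd))
    (hw : Walk k P (g :: h :: x) Q) : Linked k P Q (g :: h :: x) (h :: g :: x) := by
  refine .single ⟨?_, hw, hw.swap_comm (by tauto)⟩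
  obtain ⟨α, β, h₁⟩ := g
  obtain ⟨γ, δ, h₂⟩ := h
  rcases H with H | H | H
  · exact (BraidRel.braidMove_reverse_append (s := [⟨γ, δ, h₂⟩, ⟨α, β, h₁⟩])
      (t := [⟨α, β, h₁⟩, ⟨γ, δ, h₂⟩]) (.rel3 h₁ h₂ (Or.inl H)) x).symm
  · exact (BraidRel.braidMove_reverse_append (s := [⟨α, β, h₁⟩, ⟨γ, δ, h₂⟩])
      (t := [⟨γ, δ, h₂⟩, ⟨α, β, h₁⟩]) (.rel3 h₂ h₁ (Or.inl H)) x)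
  · exact (BraidRel.braidMove_reverse_append (s := [⟨γ, δ, h₂⟩, ⟨α, β, h₁⟩])
      (t := [⟨α, β, h₁⟩, ⟨γ, δ, h₂⟩]) (.rel3 h₁ h₂ (Or.inr H)) x).symm

theorem rel1 {α β γ δ : ℕ+} (h₁ : α < β) (h₂ : β < γ) (h₃ : γ < δ)
    (hw : Walk k P (⟨α, γ, h₁.trans h₂⟩ :: ⟨γ, δ, h₃⟩ :: ⟨β, γ, h₂⟩ :: x) Q) :
    Linked k P Q (⟨α, γ, h₁.trans h₂⟩ :: ⟨γ, δ, h₃⟩ :: ⟨β, γ, h₂⟩ :: x)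
      (⟨β, γ, h₂⟩ :: ⟨α, β, h₁⟩ :: ⟨β, δ, h₂.trans h₃⟩ :: x) :=
  .single ⟨BraidRel.braidMove_reverse_append (s := [_, _, _]) (t := [_, _, _])
    (.rel1 h₁ h₂ h₃) x, hw, walk_rel1 h₁ h₂ h₃ hw⟩

theorem rel2 {α β γ δ : ℕ+} (h₁ : α < β) (h₂ : β < γ) (h₃ : γ < δ)
    (hw : Walk k P (⟨β, δ, h₂.trans h₃⟩ :: ⟨α, β, h₁⟩ :: ⟨β, γ, h₂⟩ :: x) Q) :
    Linked k P Q (⟨β, δ, h₂.trans h₃⟩ :: ⟨α, β, h₁⟩ :: ⟨β, γ, h₂⟩ :: x)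
      (⟨β, γ, h₂⟩ :: ⟨γ, δ, h₃⟩ :: ⟨α, γ, h₁.trans h₂⟩ :: x) :=
  .single ⟨(BraidRel.braidMove_reverse_append (s := [_, _, _]) (t := [_, _, _])
    (.rel2 h₁ h₂ h₃) x).symm, hw, walk_rel2 h₁ h₂ h₃ hw⟩

end Linked

/-! ### Chains in which the top cover can be brought to the front -/

section TopCover

variable {k : ℕ} {P ζ : Equiv.Perm ℕ+} {α β c d : ℕ+} {hcd : c < d}

theorem Cov.lt_of_mem_Ioo_of_lt (hc : Cov k P ⟨c, d, hcd⟩) {x : ℕ+} (h1 : c < x) (h2 : x < d)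
    (hx : k < (P x : ℕ)) : P d < P x := by
  refine lt_of_le_of_ne (not_lt.1 fun h => hc.2.2 x h1 h2 ⟨?_, h⟩) (P.injective.ne h2.ne')
  have := hc.1
  rw [← PNat.coe_lt_coe]
  exact this.trans_lt hx

theorem Cov.lt_of_mem_Ioo_of_le (hc : Cov k P ⟨c, d, hcd⟩) {x : ℕ+} (h1 : c < x) (h2 : x < d)
    (hx : (P x : ℕ) ≤ k) : P x < P c := by
  refine lt_of_le_of_ne (not_lt.1 fun h => hc.2.2 x h1 h2 ⟨h, ?_⟩) (P.injective.ne h1.ne')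
  have := hc.2.1
  rw [← PNat.coe_lt_coe]
  exact hx.trans_lt this

theorem IsTopCover.not_mem_Ioo (t : IsTopCover ζ α β) {x : ℕ+} (hx : ¬ (α < x ∧ x < β)) :
    ¬ (α < ζ x ∧ ζ x < β) := by
  rintro ⟨h1, h2⟩
  have e := ζ.injective (t.fixed _ h1 h2)
  rw [e] at h1 h2
  exact hx ⟨h1, h2⟩

/-- A cover of a chain that starts below the top value `α` and does not end in `β` commutes with
the top cover. -/
theorem IsTopCover.step_of_lt (t : IsTopCover ζ α β) (hc : c < α) (hd : d ≠ β) (hζd : ζ d ≤ c)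
    (h : Admissible k (P * Equiv.swap c d) (ζ * Equiv.swap c d)) (hcd : c < d) :
    (d < α ∨ β < d) ∧ Cov k (P * Equiv.swap c d) ⟨α, β, t.lt⟩ ∧
      Admissible k (P * Equiv.swap c d * Equiv.swap α β)
        (ζ * Equiv.swap c d * Equiv.swap α β) := by
  have hdα : d ≠ α := by
    rintro rfl
    exact absurd ((t.lt.trans_le t.le_apply).trans_le hζd) hc.not_gt
  have hdx : ∀ x, α < x → x < β → x ≠ d := by
    rintro x h1 h2 rfl
    rw [t.fixed x h1 h2] at hζd
    exact hζd.not_gt hcd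
  have ev : ∀ x, α ≤ x → x ≠ d → (ζ * Equiv.swap c d) x = ζ x := fun x h1 h2 => by
    rw [Equiv.Perm.mul_apply, Equiv.swap_apply_of_ne_of_ne (hc.trans_le h1).ne' h2]
  refine ⟨?_, h.step_of_fixed t.lt ?_ ?_ fun x h1 h2 => ?_⟩
  · by_contra! hd'
    exact hdx d (lt_of_le_of_ne hd'.1 hdα.symm) (lt_of_le_of_ne hd'.2 hd) rfl
  · rw [ev α le_rfl hdα.symm]
    exact t.le_apply
  · rw [ev β t.lt.le hd.symm]
    exact t.apply_le
  · rw [ev x h1.le (hdx x h1 h2)]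
    exact t.fixed x h1 h2

/-- If some value below `α` is lowered, then some cover among the values below `α` is possible. -/
theorem Admissible.exists_step_lt (h : Admissible k P ζ) (hα : ∃ x, x < α ∧ ζ x < x) :
    ∃ (ε η : ℕ+) (hεη : ε < η), η < α ∧ Cov k P ⟨ε, η, hεη⟩ ∧
      Admissible k (P * Equiv.swap ε η) (ζ * Equiv.swap ε η) := by
  -- Take `η` to be the least lowered value, and `ε` the largest value of `[ζ η, η)` sent to `η` or
  -- beyond. Values between them do not fall and stay below `η`, as `Admissible.step` requires.
  obtain ⟨η, ⟨hηα, hη⟩, hmin⟩ := PNat.exists_min hα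
  have up : ∀ x, x < η → x ≤ ζ x := fun x hx => not_lt.1 fun hlt =>
    hx.not_ge (hmin x ⟨hx.trans hηα, hlt⟩)
  have ex : ∃ x, (ζ η ≤ x ∧ x < η) ∧ η ≤ ζ x := by
    by_contra! hno
    have := ζ.mem_of_apply_mem_finset (s := Finset.Ico (ζ η) η) (x := η)
      (fun x hx => by
        rw [Finset.mem_Ico] at hx ⊢
        exact ⟨hx.1.trans (up x hx.2), hno x hx⟩)
      (by simpa using hη)
    simp at this
  obtain ⟨ε, ⟨⟨h1, h2⟩, h3⟩, hmax⟩ := PNat.exists_max_of_finite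
    ((Set.finite_Iio η).subset fun x hx => hx.1.2) ex
  refine ⟨ε, η, h2, hηα, h.step h2 h3 h1 fun x l1 l2 => ⟨fun _ => ?_, fun _ => ?_⟩⟩
  · exact lt_of_lt_of_le (not_le.1 fun hx => l1.not_ge (hmax x ⟨⟨h1.trans l1.le, l2⟩, hx⟩)) h3
  · exact h1.trans_lt (l1.trans_le (up x l2))

/-- If no value below `α` is lowered, then a cover `(α d)` with `β < d` can be followed by
`(ε α)` and `(α β)`, for some `ε`. -/
theorem IsTopCover.exists_steps_of_fst_eq (t : IsTopCover ζ α β) (hβd : β < d)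
    (hc : Cov k P ⟨α, d, t.lt.trans hβd⟩) (hβ : k < (P β : ℕ))
    (h : Admissible k (P * Equiv.swap α d) (ζ * Equiv.swap α d))
    (hup : ∀ x, x < α → x ≤ (ζ * Equiv.swap α d) x) :
    ∃ (ε : ℕ+) (hεα : ε < α), Cov k (P * Equiv.swap α d) ⟨ε, α, hεα⟩ ∧
      Cov k (P * Equiv.swap α d * Equiv.swap ε α) ⟨α, β, t.lt⟩ ∧
      Admissible k (P * Equiv.swap α d * Equiv.swap ε α * Equiv.swap α β)
        (ζ * Equiv.swap α d * Equiv.swap ε α * Equiv.swap α β) := by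
  have hlt := h.mono α β t.lt
  have ev : ∀ x, x ≠ α → x ≠ d → (ζ * Equiv.swap α d) x = ζ x := fun x h1 h2 => by
    rw [Equiv.Perm.mul_apply, Equiv.swap_apply_of_ne_of_ne h1 h2]
  have evβ := ev β t.lt.ne' hβd.ne
  have hPd : k < (P d : ℕ) := hc.2.1
  simp only [Equiv.Perm.mul_apply (f := P), Equiv.swap_apply_left,
    Equiv.swap_apply_of_ne_of_ne t.lt.ne' hβd.ne] at hlt
  -- The cover `(α d)` forces `P d < P β`, so monotonicity after it gives `ζ' α < ζ' β ≤ α`: now `α`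
  -- is lowered.
  replace hlt := hlt (hc.lt_of_mem_Ioo_of_lt t.lt hβd hβ) (by omega)
  have hζβ : (ζ * Equiv.swap α d) β ≤ α := evβ ▸ t.apply_le
  have ev' : ∀ x, x < α → (ζ * Equiv.swap α d) x = ζ x := fun x hx =>
    ev x hx.ne (hx.trans (t.lt.trans hβd)).ne
  have tfix : ∀ x, α < x → x < β → (ζ * Equiv.swap α d) x = x := fun x h1 h2 =>
    (ev x h1.ne' (h2.trans hβd).ne).trans (t.fixed x h1 h2)
  set ζ' := ζ * Equiv.swap α d
  -- Otherwise `[ζ' α, α]` would be stable, although `β` is sent into it.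
  have ex : ∃ x, (ζ' α ≤ x ∧ x < α) ∧ α < ζ' x := by
    by_contra! hno
    have := ζ'.mem_of_apply_mem_finset (s := Finset.Icc (ζ' α) α) (x := β)
      (fun x hx => by
        rw [Finset.mem_Icc] at hx ⊢
        rcases hx.2.eq_or_lt with rfl | hx'
        · exact ⟨le_rfl, (hlt.trans_le hζβ).le⟩
        · exact ⟨hx.1.trans (hup x hx'), hno x ⟨hx.1, hx'⟩⟩)
      (by simpa using ⟨hlt.le, hζβ⟩)
    simp [t.lt.not_ge] at this
  obtain ⟨ε, ⟨⟨h1, h2⟩, h3⟩, hmax⟩ := PNat.exists_max_of_finite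
    ((Set.finite_Iio α).subset fun x hx => hx.1.2) ex
  obtain ⟨hc', h'⟩ := h.step h2 h3.le h1 fun x l1 l2 =>
    ⟨fun _ => lt_of_le_of_lt (not_lt.1 fun hx => l1.not_ge (hmax x ⟨⟨h1.trans l1.le, l2⟩, hx⟩)) h3,
      fun _ => h1.trans_lt (l1.trans_le (hup x l2))⟩
  refine ⟨ε, h2, hc', h'.step_of_fixed t.lt ?_ ?_ fun x m1 m2 => ?_⟩
  · rw [Equiv.Perm.mul_apply, Equiv.swap_apply_right, ev' ε h2]
    -- The values strictly between `α` and `β` are fixed, hence images of themselves only; so `ζ ε >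
    -- α` implies `ζ ε ≥ β`.
    have := t.not_mem_Ioo (x := ε) fun hx => hx.1.not_gt h2
    rw [ev' ε h2] at h3
    exact not_lt.1 fun hx => this ⟨h3, hx⟩
  · rw [Equiv.Perm.mul_apply, Equiv.swap_apply_of_ne_of_ne (h2.trans t.lt).ne' t.lt.ne']
    exact hζβ
  · rw [Equiv.Perm.mul_apply, Equiv.swap_apply_of_ne_of_ne (h2.trans m1).ne' m1.ne']
    exact tfix x m1 m2

/-- A cover `(c β)` with `c < α` can be followed by `(β θ)` and `(α β)`, for some `θ`. -/
theorem IsTopCover.exists_steps_of_snd_eq (t : IsTopCover ζ α β) (hcα : c < α)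
    (hc : Cov k P ⟨c, β, hcα.trans t.lt⟩) (hα : (P α : ℕ) ≤ k)
    (h : Admissible k (P * Equiv.swap c β) (ζ * Equiv.swap c β)) :
    ∃ (θ : ℕ+) (hβθ : β < θ), Cov k (P * Equiv.swap c β) ⟨β, θ, hβθ⟩ ∧
      Cov k (P * Equiv.swap c β * Equiv.swap β θ) ⟨α, β, t.lt⟩ ∧
      Admissible k (P * Equiv.swap c β * Equiv.swap β θ * Equiv.swap α β)
        (ζ * Equiv.swap c β * Equiv.swap β θ * Equiv.swap α β) := by
  have hlt := h.mono α β t.lt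
  have ev : ∀ x, c < x → x ≠ β → (ζ * Equiv.swap c β) x = ζ x := fun x h1 h2 => by
    rw [Equiv.Perm.mul_apply, Equiv.swap_apply_of_ne_of_ne h1.ne' h2]
  have evα := ev α hcα t.lt.ne
  have hPc : (P c : ℕ) ≤ k := hc.1
  simp only [Equiv.Perm.mul_apply (f := P), Equiv.swap_apply_right,
    Equiv.swap_apply_of_ne_of_ne hcα.ne' t.lt.ne] at hlt
  -- The cover `(c β)` forces `P α < P c`, so monotonicity after it gives `β ≤ ζ' α < ζ' β`: now `β`
  -- is raised.
  replace hlt := hlt (hc.lt_of_mem_Ioo_of_le hcα t.lt hα) (by omega)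
  have hζα : β ≤ (ζ * Equiv.swap c β) α := evα ▸ t.le_apply
  have ev' : ∀ x, β < x → (ζ * Equiv.swap c β) x = ζ x := fun x hx =>
    ev x ((hcα.trans t.lt).trans hx) hx.ne'
  have top : ∀ x, β < x → (ζ * Equiv.swap c β) x ≤ x := fun x hx =>
    (ev' x hx).trans_le (t.top x (t.lt.trans hx))
  have tfix : ∀ x, α < x → x < β → (ζ * Equiv.swap c β) x = x := fun x h1 h2 =>
    (ev x (hcα.trans h1) h2.ne).trans (t.fixed x h1 h2)
  set ζ' := ζ * Equiv.swap c β
  have ex : ∃ x, (β < x ∧ x ≤ ζ' β) ∧ ζ' x < β := by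
    by_contra! hno
    have := ζ'.mem_of_apply_mem_finset (s := Finset.Icc β (ζ' β)) (x := α)
      (fun x hx => by
        rw [Finset.mem_Icc] at hx ⊢
        rcases hx.1.eq_or_lt with rfl | hx'
        · exact ⟨hζα.trans hlt.le, le_rfl⟩
        · exact ⟨hno x ⟨hx', hx.2⟩, (top x hx').trans hx.2⟩)
      (by simpa using ⟨hζα, hlt.le⟩)
    simp [t.lt.not_ge] at this
  obtain ⟨θ, ⟨⟨h1, h2⟩, h3⟩, hmin⟩ := PNat.exists_min ex
  obtain ⟨hc', h'⟩ := h.step h1 h2 h3.le fun x l1 l2 =>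
    ⟨fun _ => (top x l1).trans_lt (l2.trans_le h2), fun _ => h3.trans_le
      (not_lt.1 fun hx => l2.not_ge (hmin x ⟨⟨l1, l2.le.trans h2⟩, hx⟩))⟩
  refine ⟨θ, h1, hc', h'.step_of_fixed t.lt ?_ ?_ fun x m1 m2 => ?_⟩
  · rw [Equiv.Perm.mul_apply, Equiv.swap_apply_of_ne_of_ne t.lt.ne (t.lt.trans h1).ne]
    exact hζα
  · rw [Equiv.Perm.mul_apply, Equiv.swap_apply_left, ev' θ h1]
    have := t.not_mem_Ioo (x := θ) fun hx => hx.2.not_gt h1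
    rw [ev' θ h1] at h3
    exact not_lt.1 fun hx => this ⟨hx, h3⟩
  · rw [Equiv.Perm.mul_apply, Equiv.swap_apply_of_ne_of_ne m2.ne (m2.trans h1).ne]
    exact tfix x m1 m2

end TopCover

theorem Walk.exists_linked_top {k n : ℕ} {P Q : Equiv.Perm ℕ+} {α β : ℕ+}
    (ih : ∀ (P : Equiv.Perm ℕ+) (l m : GenWord), P ∈ SInfty → Walk k P l Q → Walk k P m Q →
      l.length = n → Linked k P Q l m)
    (hP : P ∈ SInfty) (hQ : Q ∈ SInfty) (t : IsTopCover (Q⁻¹ * P) α β) {g : Gen} {l : GenWord}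
    (hl : l.length = n) (hw : Walk k P (g :: l) Q) :
    ∃ m, Linked k P Q (g :: l) (⟨α, β, t.lt⟩ :: m) := by
  have H := hw.admissible
  have H' := hw.2.admissible
  have hc := hw.1
  obtain ⟨c, d, hcd⟩ := g
  simp only [← mul_assoc] at H'
  have hζc : d ≤ (Q⁻¹ * P) c := by
    have := H'.low d
    simp only [Equiv.Perm.mul_apply, Equiv.swap_apply_right] at this
    exact this hc.1
  have hζd : (Q⁻¹ * P) d ≤ c := by
    have := H'.high c
    simp only [Equiv.Perm.mul_apply, Equiv.swap_apply_left] at this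
    exact this hc.2.1
  have walks : ∀ {R : Equiv.Perm ℕ+}, R ∈ SInfty → Admissible k R (Q⁻¹ * R) →
      ∃ m, Walk k R m Q := fun h1 h2 => h2.exists_walk (mul_mem (inv_mem hQ) h1)
  have hs : ∀ {R : Equiv.Perm ℕ+}, R ∈ SInfty → ∀ a b, R * Equiv.swap a b ∈ SInfty :=
    SInfty.mul_swap_mem
  -- The induction hypothesis makes the tail after `(c d)` freely exchangeable.
  have linkTail : ∀ {m : GenWord}, Walk k (P * Equiv.swap c d) m Q →
      Linked k P Q (⟨c, d, hcd⟩ :: l) (⟨c, d, hcd⟩ :: m) := fun hm =>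
    .cons hc (ih _ _ _ (hs hP c d) hw.2 hm hl)
  have hcα : c ≤ α := not_lt.1 fun h => (t.top c h).not_gt (hcd.trans_le hζc)
  rcases hcα.eq_or_lt with rfl | hcα
  · have hβd : β ≤ d := not_lt.1 fun h => by
      rw [t.fixed d hcd h] at hζd
      exact hζd.not_gt hcd
    rcases hβd.eq_or_lt with rfl | hβd
    · exact ⟨l, .refl⟩
    have hβ : k < (P β : ℕ) := by
      by_contra! hk
      exact ((H.low β hk).trans t.apply_le).not_gt t.lt
    -- If a value below `α` is lowered, a letter `(ε η)` with `η < α` is moved to the front. Since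
    -- `ζ` is unchanged on values from `α` on, `(α β)` can follow it; a second use of induction puts
    -- it there, and it commutes with `(ε η)`.
    by_cases hdown : ∃ x, x < c ∧ (Q⁻¹ * P * Equiv.swap c d) x < x
    · obtain ⟨ε, η, hεη, hη, hc2, h2⟩ := H'.exists_step_lt hdown
      simp only [mul_assoc Q⁻¹] at h2
      obtain ⟨m, hm⟩ := walks (hs (hs hP c d) ε η) h2
      have L1 := (linkTail (.cons hc2 hm)).trans (.swap_comm (Or.inr (Or.inl hη)) ⟨hc, hc2, hm⟩)
      have hw1 := L1.walk hw
      have H1 := hw1.2.admissible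
      have ev : ∀ x, c ≤ x → (Q⁻¹ * (P * Equiv.swap ε η)) x = (Q⁻¹ * P) x := fun x hx => by
        rw [← mul_assoc, Equiv.Perm.mul_apply (Q⁻¹ * P), Equiv.swap_apply_of_ne_of_ne
          (hεη.trans (hη.trans_le hx)).ne' (hη.trans_le hx).ne']
      obtain ⟨hc3, h3⟩ := H1.step_of_fixed t.lt (by rw [ev c le_rfl]; exact t.le_apply)
        (by rw [ev β t.lt.le]; exact t.apply_le)
        fun x m1 m2 => by rw [ev x m1.le]; exact t.fixed x m1 m2
      rw [mul_assoc] at h3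
      obtain ⟨m', hm'⟩ := walks (hs (hs hP ε η) c β) h3
      have len := L1.length_eq
      refine ⟨_, (L1.trans (.cons hw1.1 (ih _ _ _ (hs hP ε η) hw1.2 (.cons hc3 hm') ?_))).trans
        (.swap_comm (Or.inl hη) ⟨hw1.1, hc3, hm'⟩)⟩
      simp only [List.length_cons] at len ⊢
      omega
    · push Not at hdown
      -- The tail is chosen to give `(α d)`, `(ε α)`, `(α β)`, one side of (2), whose other side
      -- begins with `(α β)`.
      obtain ⟨ε, hε, hc2, hc3, h3⟩ := t.exists_steps_of_fst_eq hβd hc hβ H' hdown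
      simp only [mul_assoc Q⁻¹] at h3
      obtain ⟨m, hm⟩ := walks (hs (hs (hs hP c d) ε c) c β) h3
      exact ⟨_, (linkTail (.cons hc2 (.cons hc3 hm))).trans (.rel2 hε t.lt hβd ⟨hc, hc2, hc3, hm⟩)⟩
  · by_cases hd : d = β
    · subst hd
      have hα : (P α : ℕ) ≤ k := by
        by_contra! hk
        exact (t.le_apply.trans (H.high α hk)).not_gt t.lt
      -- Here the chain becomes `(c β)`, `(β θ)`, `(α β)`, one side of (1).
      obtain ⟨θ, hθ, hc2, hc3, h3⟩ := t.exists_steps_of_snd_eq hcα hc hα H'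
      simp only [mul_assoc Q⁻¹] at h3
      obtain ⟨m, hm⟩ := walks (hs (hs (hs hP c d) d θ) α d) h3
      exact ⟨_, (linkTail (.cons hc2 (.cons hc3 hm))).trans (.rel1 hcα t.lt hθ ⟨hc, hc2, hc3, hm⟩)⟩
    · obtain ⟨hor, hc2, h2⟩ := t.step_of_lt hcα hd hζd H' hcd
      simp only [mul_assoc Q⁻¹] at h2
      obtain ⟨m, hm⟩ := walks (hs (hs hP c d) α β) h2
      exact ⟨_, (linkTail (.cons hc2 hm)).trans (.swap_comm
        (hor.elim Or.inl fun h => Or.inr (Or.inr ⟨hcα, h⟩)) ⟨hc, hc2, hm⟩)⟩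

/-! ### Induction on the length of chains -/

theorem Walk.ne_of_cons {k : ℕ} {P Q : Equiv.Perm ℕ+} {g : Gen} {l : GenWord}
    (hw : Walk k P (g :: l) Q) : Q⁻¹ * P ≠ 1 := by
  intro h
  have := hw.2.admissible.low g.snd
  rw [← mul_assoc, h] at this
  simp only [Equiv.Perm.mul_apply, Equiv.swap_apply_right, Equiv.Perm.one_apply] at this
  exact (this hw.1.1).not_gt g.lt

theorem IsMaximalChain.length_eq {k : ℕ} {u w : SInfty} {x : GenWord}
    (h : IsMaximalChain k u x w) : SInfty.length w = SInfty.length u + x.length := by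
  induction h with
  | nil => rfl
  | cons g _ hc ih =>
    obtain ⟨_, _, _, _, _, hl⟩ := SInfty.kCovBy_iff_kStep.1 hc
    rw [hl, ih, List.length_cons, add_assoc]

theorem Walk.length_eq_length {k : ℕ} {P Q : Equiv.Perm ℕ+} (hP : P ∈ SInfty) (hQ : Q ∈ SInfty)
    {l m : GenWord} (hl : Walk k P l Q) (hm : Walk k P m Q) : l.length = m.length := by
  have key : ∀ {x : GenWord}, Walk k P x Q →
      SInfty.length (⟨Q, hQ⟩⁻¹) = SInfty.length (⟨P, hP⟩⁻¹) + x.length := fun {x} hx => by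
    rw [← List.length_reverse]
    refine (isMaximalChain_iff_walk (k := k).2 ?_).length_eq
    simpa using hx
  have := key hl
  have := key hm
  omega

theorem Walk.linked {k : ℕ} {P Q : Equiv.Perm ℕ+} {l m : GenWord} (hP : P ∈ SInfty)
    (hQ : Q ∈ SInfty) (hl : Walk k P l Q) (hm : Walk k P m Q) : Linked k P Q l m := by
  induction hn : l.length generalizing P l m with
  | zero =>
    have hlen := hl.length_eq_length hP hQ hm
    rw [List.length_eq_zero_iff.1 hn, List.length_eq_zero_iff.1 (hlen.symm.trans hn)]
    exact .refl
  | succ n ih =>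
    have ih' : ∀ (P : Equiv.Perm ℕ+) (l m : GenWord), P ∈ SInfty → Walk k P l Q →
        Walk k P m Q → l.length = n → Linked k P Q l m :=
      fun P l m hP hl hm hn => ih hP hl hm hn
    have hlen := (hl.length_eq_length hP hQ hm).symm.trans hn
    obtain _ | ⟨g, l⟩ := l
    · simp at hn
    obtain _ | ⟨h, m⟩ := m
    · simp at hlen
    rw [List.length_cons, add_left_inj] at hn hlen
    obtain ⟨α, β, t⟩ := exists_isTopCover (mul_mem (inv_mem hQ) hP) hl.ne_of_cons
    obtain ⟨l', L⟩ := hl.exists_linked_top ih' hP hQ t hn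
    obtain ⟨m', M⟩ := hm.exists_linked_top ih' hP hQ t hlen
    have wl := L.walk hl
    have ll := L.length_eq
    rw [List.length_cons, List.length_cons, add_left_inj] at ll
    exact (L.trans (.cons wl.1 (ih (SInfty.mul_swap_mem hP _ _) wl.2 (M.walk hm).2
      (ll.symm.trans hn)))).trans M.symm

theorem mainTheorem2 (k : ℕ) (u w : SInfty) (huw : SInfty.KLe k u w) :
    (∀ x y : GenWord, IsMaximalChain k u x w → IsMaximalChain k u y w →
      Relation.ReflTransGen (fun z z' => BraidMove z z' ∧ IsMaximalChain k u z' w) x y) ∧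
    (∀ x : GenWord, IsMaximalChain k u x w → ¬ ZeroApplies x) := by
  refine ⟨fun x y hx hy => ?_, fun x hx => hx.not_zeroApplies⟩
  have L := Walk.linked (inv_mem u.2) (inv_mem w.2) (isMaximalChain_iff_walk.1 hx)
    (isMaximalChain_iff_walk.1 hy)
  have := Relation.ReflTransGen.lift (p := fun z z' => BraidMove z z' ∧ IsMaximalChain k u z' w)
    List.reverse (fun a b h => ⟨h.1, by
      rw [isMaximalChain_iff_walk, List.reverse_reverse]
      exact h.2.2⟩) _ _ L
  simpa only [Function.onFun, List.reverse_reverse] using this
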